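/- Let $\mathsf B$ be a locally presentable abelian category with enough projective objects, and let $\mathsf B_{\mathrm{proj}}\subset\mathsf B$ be the full subcategory of projective objects. Let $\mathsf K(\mathsf B)$ and $\mathsf K(\mathsf B_{\mathrm{proj}})$ denote the homotopy categories of unbounded cochain complexes in $\mathsf B$ and in $\mathsf B_{\mathrm{proj}}$. Call a complex $X\in\mathsf K(\mathsf B)$ contraacyclic (in the sense of Becker) if $\operatorname{Hom}_{\mathsf K(\mathsf B)}(P,X)=0$ for every complex $P\in\mathsf K(\mathsf B_{\mathrm{proj}})$. The contraacyclic complexes form a full triangulated subcategory $\mathsf K(\mathsf B)^{\mathrm{ctr}}_{\mathrm{ac}}\subset\mathsf K(\mathsf B)$; the Verdier quotient category $\mathsf D^{\mathrm{ctr}}(\mathsf B)=\mathsf K(\mathsf B)/\mathsf K(\mathsf B)^{\mathrm{ctr}}_{\mathrm{ac}}$ is called the contraderived category of $\mathsf B$. Then the composition $$\mathsf K(\mathsf B_{\mathrm{proj}})\longrightarrow\mathsf K(\mathsf B)\longrightarrow\mathsf D^{\mathrm{ctr}}(\mathsf B)$$ of the inclusion functor with the Verdier quotient functor is a triangulated equivalence,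 that is, a triangulated functor which is an equivalence of categories. In terms of the full subcategory $\mathsf K(\mathsf B_{\mathrm{proj}})\subset\mathsf K(\mathsf B)$, this means that the inclusion functor $\mathsf K(\mathsf B_{\mathrm{proj}})\to\mathsf K(\mathsf B)$ has a right adjoint; so this holds as well. -/

import Mathlib

open CategoryTheory CategoryTheory.Limits

universe v u

namespace Contraderived

noncomputable section

variable (B : Type u) [Category.{v} B] [Abelian B]

/-- The full subcategory `B_proj` of projective objects of `B`. -/
abbrev ProjObj : Type u := (isProjective B).FullSubcategory

instance isProjective_containsZero : (isProjective B).ContainsZero where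
  exists_zero := by
    obtain ⟨Z, hZ⟩ := HasZeroObject.zero (C := B)
    exact ⟨Z, hZ, ⟨fun _ _ _ ↦ ⟨0, hZ.eq_of_src _ _⟩⟩⟩

instance hasBinaryBiproducts_projObj : HasBinaryBiproducts (ProjObj B) where
  has_binary_biproduct P Q := HasBinaryBiproduct.mk
    { bicone :=
        { pt := ⟨P.obj ⊞ Q.obj,
            have := P.property
            have := Q.property
            (inferInstance : Projective (P.obj ⊞ Q.obj))⟩
          fst := ObjectProperty.homMk biprod.fst
          snd := ObjectProperty.homMk biprod.snd
          inl := ObjectProperty.homMk biprod.inl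
          inr := ObjectProperty.homMk biprod.inr
          inl_fst := by ext; simp
          inl_snd := by ext; simp
          inr_fst := by ext; simp
          inr_snd := by ext; simp }
      isBilimit := isBinaryBilimitOfTotal _ (ObjectProperty.hom_ext _ biprod.total) }

/-- The (unbounded) homotopy category `K(B)` of cochain complexes in `B`, with its standard
triangulated structure. -/
abbrev K : Type (max u v) := HomotopyCategory B (ComplexShape.up ℤ)

/-- The (unbounded) homotopy category `K(B_proj)` of cochain complexes of projective
objects of `B`, with its standard triangulated structure. -/
abbrev KProj : Type (max u v) := HomotopyCategory (ProjObj B) (ComplexShape.up ℤ)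

/-- The inclusion functor `K(B_proj) ⥤ K(B)`, induced by the inclusion of the full
subcategory `B_proj` into `B`. -/
abbrev inclusion : KProj B ⥤ K B :=
  (isProjective B).ι.mapHomotopyCategory (ComplexShape.up ℤ)

/-- A complex `X` is contraacyclic (in the sense of Becker) if every morphism `P ⟶ X` in
`K(B)` from a complex of projective objects `P` is zero. -/
def contraacyclic : ObjectProperty (K B) :=
  fun X ↦ ∀ (P : KProj B) (f : (inclusion B).obj P ⟶ X), f = 0

lemma contraacyclic_eq_rightOrthogonal :
    contraacyclic B = (inclusion B).essImage.rightOrthogonal := by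
  ext X
  constructor
  · rintro hX Y f ⟨P, ⟨e⟩⟩
    rw [← cancel_epi e.hom, hX P (e.hom ≫ f), comp_zero]
  · intro hX P f
    exact hX f ((inclusion B).obj_mem_essImage P)

/-- The contraacyclic complexes form a triangulated subcategory of `K(B)`. -/
instance isTriangulated_contraacyclic : (contraacyclic B).IsTriangulated := by
  rw [contraacyclic_eq_rightOrthogonal]
  infer_instance

/-- The contraderived category `D^ctr(B)` (in the sense of Becker): the Verdier quotient of
`K(B)` by the triangulated subcategory of contraacyclic complexes, i.e. the localization of
`K(B)` at the class of all morphisms whose cone is contraacyclic, with the triangulated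
structure induced from `K(B)`. -/
abbrev DCtr : Type (max u v) := (contraacyclic B).trW.Localization

/-- The Verdier quotient functor `K(B) ⥤ D^ctr(B)`. -/
abbrev quotientFunctor : K B ⥤ DCtr B := (contraacyclic B).trW.Q

/-- The composite `K(B_proj) ⥤ K(B) ⥤ D^ctr(B)`. -/
abbrev comparison : KProj B ⥤ DCtr B := inclusion B ⋙ quotientFunctor B

end

end Contraderived

namespace Contraderived

open CochainComplex HomComplex Pretriangulated
open scoped ZeroObject

/-! Everything reduces to one construction: each complex `X` receives a morphism from a complex of
projectives with contraacyclic cone (`exists_trW_contraacyclic`). Complexes of projectives are left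
orthogonal to contraacyclic complexes, so morphisms out of them see neither such a cone nor the
passage to the Verdier quotient. The first fact gives the right adjoint and the second full
faithfulness; the construction gives essential surjectivity.

For the construction, choose a projective separator `P` and an uncountable regular `κ` for which `P`
is `κ`-presentable. Complexes whose terms are coproducts of fewer than `κ` copies of `P` form a set
up to isomorphism. The small object argument for their inclusions `S ⟶ cone (𝟙 S)`, applied to `X ⟶
0`, yields `X ⟶ Y`, degreewise split with projective cokernel, such that every `S ⟶ Y` is
null-homotopic. Shifting the cokernel by `-1` gives the desired complex over `X`.

That `Y` is contraacyclic is the main point (`isCoboundary_of_projective`). A complex of projectives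
is a retract of one with terms coproducts of copies of `P`. In the latter, each basis element lies
in a set of fewer than `κ` basis elements closed under the differential, so Zorn's lemma extends a
null-homotopy one small subquotient at a time. -/

/-! ### Projective separators and presentability -/

/-- A locally presentable abelian category with enough projectives
has a projective separator. -/
lemma exists_projective_isSeparator (B : Type u) [Category.{v} B] [Abelian B]
    [IsLocallyPresentable.{v} B] [EnoughProjectives B] :
    ∃ P : B, Projective P ∧ IsSeparator P := by
  obtain ⟨κ, _, _⟩ := IsLocallyPresentable.exists_cardinal.{v} B
  obtain ⟨S, _, hS⟩ := HasCardinalFilteredGenerator.exists_small_generator B κ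
  have hsep := hS.isStrongGenerator.isSeparating
  obtain ⟨ι, G, hG⟩ : ∃ (ι : Type v) (G : ι → B), S = ObjectProperty.ofObj G := by
    refine ⟨Shrink.{v} (Subtype S), fun i ↦ ((equivShrink _).symm i).1, ?_⟩
    ext X
    refine ⟨fun hX ↦ ?_, ?_⟩
    · simpa using ObjectProperty.ofObj_apply
        (fun i : Shrink.{v} (Subtype S) ↦ ((equivShrink _).symm i).1) (equivShrink _ ⟨X, hX⟩)
    · rintro ⟨i⟩
      exact ((equivShrink _).symm i).2
  have hsep' : IsSeparator (∐ G) := (isSeparator_sigma G).2 (hG ▸ hsep)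
  refine ⟨Projective.over (∐ G), inferInstance, (Preadditive.isSeparator_iff _).2 ?_⟩
  intro X Y f hf
  refine (Preadditive.isSeparator_iff _).1 hsep' f fun h ↦ ?_
  rw [← cancel_epi (Projective.π (∐ G)), comp_zero, ← Category.assoc]
  exact hf _

/-- If `P` is a separator, every projective object is a retract of a coproduct of copies of `P`. -/
lemma exists_retract_sigma {B : Type u} [Category.{v} B] [Abelian B] [HasCoproducts.{v} B]
    {P : B} (hP : IsSeparator P) (X : B) [Projective X] :
    ∃ ι : Type v, Nonempty (Retract X (∐ fun _ : ι ↦ P)) := by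
  have := (isSeparator_iff_epi P).1 hP X
  exact ⟨P ⟶ X, ⟨{ i := Projective.factorThru (𝟙 X) (Sigma.desc fun f : P ⟶ X ↦ f)
                   r := Sigma.desc fun f : P ⟶ X ↦ f }⟩⟩

/-- Any object of a locally presentable category is `κ`-presentable for some uncountable
regular cardinal `κ`. -/
lemma exists_isCardinalPresentable_of_aleph0_lt {B : Type u} [Category.{v} B]
    [IsLocallyPresentable.{v} B] (P : B) :
    ∃ (κ : Cardinal.{v}) (_ : Fact κ.IsRegular), Cardinal.aleph0 < κ ∧
      IsCardinalPresentable P κ := by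
  obtain ⟨κ₀, _, hκ₀⟩ := (inferInstance : IsPresentable.{v} P).exists_cardinal
  -- Infinite successor cardinals are regular, and this one exceeds `ℵ₀` strictly.
  have hle : κ₀ ≤ Order.succ (max κ₀ Cardinal.aleph0) := (le_max_left _ _).trans (Order.le_succ _)
  let κ := Order.succ (max κ₀ Cardinal.aleph0)
  have : Fact κ.IsRegular := ⟨Cardinal.isRegular_succ (le_max_right _ _)⟩
  have : IsCardinalPresentable P κ₀ := hκ₀
  exact ⟨κ, inferInstance, Order.lt_succ_of_le (le_max_right _ _),
    isCardinalPresentable_of_le P hle⟩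

lemma hasColimits_of_isLocallyPresentable (B : Type u) [Category.{v} B]
    [IsLocallyPresentable.{v} B] : HasColimits B := by
  obtain ⟨κ, _, _⟩ := IsLocallyPresentable.exists_cardinal.{v} B
  infer_instance

/-! ### Supports of morphisms into coproducts -/

section Supported

variable {B : Type u} [Category.{v} B] [HasZeroMorphisms B] {P X A : B} {ι : Type v}

/-- A morphism `x : A ⟶ X` is supported on a subset `J` of a family `b` of morphisms to `X` if it
is annihilated by every morphism which annihilates the members of `J`. When `X` is the
coproduct of the sources of the members of `b`, this means that `x` factors through
the partial coproduct indexed by `J`. -/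
def Supported (b : ι → (P ⟶ X)) (J : Set ι) (x : A ⟶ X) : Prop :=
  ∀ ⦃Z : B⦄ (φ : X ⟶ Z), (∀ j ∈ J, b j ≫ φ = 0) → x ≫ φ = 0

lemma Supported.mono {b : ι → (P ⟶ X)} {J J' : Set ι} {x : A ⟶ X} (h : Supported b J x)
    (hJ : J ⊆ J') : Supported b J' x :=
  fun _ φ hφ ↦ h φ fun j hj ↦ hφ j (hJ hj)

/-- Any morphism from a `κ`-presentable object to a coproduct is supported on a set of
cardinality less than `κ`. -/
lemma exists_supported [HasCoproducts.{v} B] (κ : Cardinal.{v}) [hκ : Fact κ.IsRegular]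
    [IsCardinalPresentable A κ] {b : ι → (P ⟶ X)} (hb : IsColimit (Cofan.mk X b))
    (x : A ⟶ X) : ∃ J : Set ι, HasCardinalLT J κ ∧ Supported b J x := by
  classical
  -- The coproduct is the `κ`-filtered colimit of its partial coproducts on fewer than `κ` indices.
  let F : HasCardinalLT.Set ι κ ⥤ B :=
    { obj J := ∐ fun _ : J.1 ↦ P
      map {J J'} f := Sigma.desc fun j : J.1 ↦
        Sigma.ι (fun _ : J'.1 ↦ P) ⟨j.1, leOfHom f j.2⟩ }
  let c : Cocone F :=
    { pt := X
      ι := { app J := Sigma.desc fun j : J.1 ↦ b j.1 } }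
  have hsing (i : ι) : HasCardinalLT ({i} : Set ι) κ :=
    hasCardinalLT_of_finite _ _ hκ.out.aleph0_le
  let sing (i : ι) : HasCardinalLT.Set ι κ := ⟨{i}, hsing i⟩
  have hmem (i : ι) : i ∈ (sing i).1 := Set.mem_singleton i
  have hcι (J : HasCardinalLT.Set ι κ) (j : J.1) :
      Sigma.ι (fun _ : J.1 ↦ P) j ≫ c.ι.app J = b j.1 := by simp [c]
  have hFmap {J J' : HasCardinalLT.Set ι κ} (f : J ⟶ J') (j : J.1) :
      Sigma.ι (fun _ : J.1 ↦ P) j ≫ F.map f =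
        Sigma.ι (fun _ : J'.1 ↦ P) ⟨j.1, leOfHom f j.2⟩ := by simp [F]
  have hdesc {Z : B} (g : ι → (P ⟶ Z)) (i : ι) : b i ≫ Cofan.IsColimit.desc hb g = g i :=
    Cofan.IsColimit.fac hb g i
  let g (s : Cocone F) (i : ι) : P ⟶ s.pt :=
    Sigma.ι (fun _ : (sing i).1 ↦ P) ⟨i, hmem i⟩ ≫ s.ι.app (sing i)
  have hc : IsColimit c :=
    { desc s := Cofan.IsColimit.desc hb (g s)
      fac s J := by
        refine Sigma.hom_ext _ _ fun j ↦ ?_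
        have hle : sing j.1 ≤ J := by rintro _ rfl; exact j.2
        have h₁ := s.w (homOfLE hle)
        have h₂ := hFmap (homOfLE hle) ⟨j.1, hmem j.1⟩
        rw [reassoc_of% (hcι J j), hdesc]
        dsimp only [g]
        rw [← h₁, reassoc_of% h₂]
      uniq s m hm := by
        refine Cofan.IsColimit.hom_ext hb _ _ fun i ↦ ?_
        have h₁ := Sigma.ι (fun _ : (sing i).1 ↦ P) ⟨i, hmem i⟩ ≫= hm (sing i)
        rw [reassoc_of% (hcι (sing i) ⟨i, hmem i⟩)] at h₁
        exact h₁.trans (hdesc (g s) i).symm }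
  obtain ⟨J, y, hy⟩ := IsCardinalPresentable.exists_hom_of_isColimit κ hc x
  refine ⟨J.1, J.2, fun Z φ hφ ↦ ?_⟩
  have : c.ι.app J ≫ φ = 0 := Sigma.hom_ext _ _ fun j ↦ by
    rw [reassoc_of% (hcι J j), hφ _ j.2, comp_zero]
  rw [← hy, Category.assoc, this, comp_zero]

end Supported

/-- A cochain complex with `κ`-presentable terms is `κ`-presentable when `κ` is uncountable. -/
lemma isCardinalPresentable_cochainComplex {B : Type u} [Category.{v} B] [HasZeroMorphisms B]
    [HasColimitsOfSize.{v, v} B] (S : CochainComplex B ℤ) (κ : Cardinal.{v}) [hκ : Fact κ.IsRegular]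
    (hκ' : Cardinal.aleph0 < κ) [∀ n, IsCardinalPresentable (S.X n) κ] :
    IsCardinalPresentable S κ where
  preservesColimitOfShape {J _ _} := ⟨fun {F} ↦ ⟨fun {c} hc ↦ ⟨by
    have := isFiltered_of_isCardinalFiltered J κ
    have hℤ : HasCardinalLT ℤ κ := by
      rw [HasCardinalLT]
      simpa using hκ'
    have hc' (n : ℤ) := isColimitOfPreserves (HomologicalComplex.eval B (.up ℤ) n) hc
    have exists_hom (n : ℤ) (f : S.X n ⟶ c.pt.X n) :
        ∃ (j : J) (y : S.X n ⟶ (F.obj j).X n), y ≫ (c.ι.app j).f n = f :=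
      IsCardinalPresentable.exists_hom_of_isColimit κ (hc' n) f
    have exists_eq (p q : ℤ) {j : J} (f g : S.X p ⟶ (F.obj j).X q)
        (h : f ≫ (c.ι.app j).f q = g ≫ (c.ι.app j).f q) :
        ∃ (k : J) (u : j ⟶ k), f ≫ (F.map u).f q = g ≫ (F.map u).f q :=
      IsCardinalPresentable.exists_eq_of_isColimit' κ (hc' q) f g h
    have exists_eq' {j : J} (f g : ∀ n : ℤ, S.X n ⟶ (F.obj j).X (n + 1))
        (h : ∀ n, f n ≫ (c.ι.app j).f (n + 1) = g n ≫ (c.ι.app j).f (n + 1)) :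
        ∃ (k : J) (u : j ⟶ k), ∀ n, f n ≫ (F.map u).f (n + 1) = g n ≫ (F.map u).f (n + 1) := by
      choose k u hu using fun n ↦ exists_eq n (n + 1) (f n) (g n) (h n)
      obtain ⟨m, a, b, hb⟩ := IsCardinalFiltered.wideSpan u hℤ
      refine ⟨m, b, fun n ↦ ?_⟩
      rw [← hb n, F.map_comp, HomologicalComplex.comp_f, reassoc_of% (hu n)]
    have surj (f : S ⟶ c.pt) : ∃ (j : J) (y : S ⟶ F.obj j), y ≫ c.ι.app j = f := by
      choose j y hy using fun n ↦ exists_hom n (f.f n)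
      let m := IsCardinalFiltered.max j hℤ
      let z (n : ℤ) : S.X n ⟶ (F.obj m).X n := y n ≫ (F.map (IsCardinalFiltered.toMax j hℤ n)).f n
      have hz (n : ℤ) : z n ≫ (c.ι.app m).f n = f.f n := by
        rw [← hy n, Category.assoc, ← HomologicalComplex.comp_f, c.w]
      clear_value z
      -- The `z n` commute with differentials only in the colimit; as `ℤ` has fewer than `κ`
      -- elements, one later stage works in all degrees.
      obtain ⟨k, u, hu⟩ := exists_eq' (j := m) (fun n ↦ z n ≫ (F.obj m).d n (n + 1))
        (fun n ↦ S.d n (n + 1) ≫ z (n + 1)) (fun n ↦ by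
          have comm : (c.ι.app m).f n ≫ c.pt.d n (n + 1) =
            (F.obj m).d n (n + 1) ≫ (c.ι.app m).f (n + 1) := (c.ι.app m).comm n (n + 1)
          rw [Category.assoc, Category.assoc, hz, ← f.comm, ← hz n, Category.assoc, comm])
      refine ⟨k, { f := fun n ↦ z n ≫ (F.map u).f n, comm' := ?_ }, ?_⟩
      · rintro n _ rfl
        simpa using hu n
      · ext n
        dsimp
        rw [Category.assoc, ← HomologicalComplex.comp_f, c.w]
        exact hz n
    have inj {j : J} (f g : S ⟶ F.obj j) (h : f ≫ c.ι.app j = g ≫ c.ι.app j) :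
        ∃ (k : J) (u : j ⟶ k), f ≫ F.map u = g ≫ F.map u := by
      choose k u hu using fun n ↦ exists_eq n n (f.f n) (g.f n)
        (by simpa using congr_arg (fun φ : S ⟶ c.pt ↦ φ.f n) h)
      obtain ⟨m, a, b, hb⟩ := IsCardinalFiltered.wideSpan u hℤ
      refine ⟨m, b, ?_⟩
      ext n
      simp only [← hb n, F.map_comp, HomologicalComplex.comp_f, reassoc_of% (hu n)]
    refine Types.FilteredColimit.isColimitOf' _ _ (fun f ↦ ?_) (fun j f g h ↦ inj f g h)
    obtain ⟨j, y, hy⟩ := surj f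
    exact ⟨j, y, hy.symm⟩⟩⟩⟩

/-! ### Sets of basis elements closed under the differential -/

section Basis

variable {B : Type u} [Category.{v} B] [Preadditive B] {P : B}
  {T : CochainComplex B ℤ} {ι : ℤ → Type v} (b : ∀ n, ι n → (P ⟶ T.X n))

/-- Given families `b n` of morphisms from `P` to the terms of a complex `T`, a set of
members of these families is closed under the differential if the differential of any of its
members is supported on it. -/
def DifferentialClosed (J : Set (Σ n, ι n)) : Prop :=
  ∀ ⦃n : ℤ⦄ (i : ι n), ⟨n, i⟩ ∈ J →
    Supported (b (n + 1)) (Sigma.mk (n + 1) ⁻¹' J) (b n i ≫ T.d n (n + 1))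

variable {b}

lemma DifferentialClosed.union {J C : Set (Σ n, ι n)} (hJ : DifferentialClosed b J)
    (hC : DifferentialClosed b C) : DifferentialClosed b (J ∪ C) := by
  rintro n i (hi | hi)
  · exact (hJ i hi).mono fun _ h ↦ Or.inl h
  · exact (hC i hi).mono fun _ h ↦ Or.inr h

/-- Any basis element is contained in a set of cardinality less than `κ` which is closed under the
differential. -/
lemma exists_differentialClosed [HasCoproducts.{v} B] (κ : Cardinal.{v}) [hκ : Fact κ.IsRegular]
    (hκ' : Cardinal.aleph0 < κ) [IsCardinalPresentable P κ]
    (hb : ∀ n, IsColimit (Cofan.mk (T.X n) (b n))) (e : Σ n, ι n) :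
    ∃ C : Set (Σ n, ι n), e ∈ C ∧ HasCardinalLT C κ ∧ DifferentialClosed b C := by
  choose A hA₁ hA₂ using fun (e : Σ n, ι n) ↦
    exists_supported κ (hb (e.1 + 1)) (b e.1 e.2 ≫ T.d e.1 (e.1 + 1))
  let A' (e : Σ n, ι n) : Set (Σ n, ι n) := Sigma.mk (e.1 + 1) '' A e
  have hA' (e) : HasCardinalLT (A' e) κ := by
    refine (hA₁ e).of_surjective (fun i ↦ ⟨⟨_, i.1⟩, i.1, i.2, rfl⟩) ?_
    rintro ⟨_, i, hi, rfl⟩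
    exact ⟨⟨i, hi⟩, rfl⟩
  -- Supports of differentials are taken `ω` times: regularity bounds each stage, uncountability of
  -- `κ` the union.
  let s : ℕ → Set (Σ n, ι n) := fun k ↦ Nat.rec {e} (fun _ s ↦ ⋃ x : s, A' x.1) k
  have hs (k : ℕ) : HasCardinalLT ↥(s k) κ := by
    induction k with
    | zero => exact hasCardinalLT_of_finite ({e} : Set (Σ n, ι n)) _ hκ.out.aleph0_le
    | succ k hk => exact hasCardinalLT_iUnion (fun x : s k ↦ A' x.1) hk (fun x ↦ hA' x.1)
  have hℕ : HasCardinalLT ℕ κ := by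
    rw [HasCardinalLT]
    simpa using hκ'
  refine ⟨⋃ k, s k, Set.mem_iUnion.2 ⟨0, rfl⟩, hasCardinalLT_iUnion _ hℕ hs, ?_⟩
  intro n i hi
  obtain ⟨k, hk⟩ := Set.mem_iUnion.1 hi
  refine (hA₂ ⟨n, i⟩).mono fun j hj ↦ Set.mem_iUnion.2 ⟨k + 1, ?_⟩
  exact Set.mem_iUnion.2 ⟨⟨_, hk⟩, j, hj, rfl⟩

/-- Two cochains which agree on a set closed under the differential have differentials which
agree on it. -/
lemma DifferentialClosed.comp_δ_eq {Y : CochainComplex B ℤ} {J : Set (Σ n, ι n)}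
    (hJ : DifferentialClosed b J) {z z' : Cochain T Y (-1)}
    (h : ∀ (n : ℤ) (i : ι n), ⟨n, i⟩ ∈ J → ∀ (m : ℤ) (hm : n + (-1) = m),
      b n i ≫ z.v n m hm = b n i ≫ z'.v n m hm)
    {n : ℤ} (i : ι n) (hi : ⟨n, i⟩ ∈ J) :
    b n i ≫ (δ (-1) 0 z).v n n (add_zero n) = b n i ≫ (δ (-1) 0 z').v n n (add_zero n) := by
  -- The only term of `δ z` that leaves `b n i` evaluates `z` on its differential, which is
  -- supported on `J`; hence the test against `z - z'`.
  have key := hJ i hi (z.v (n + 1) n (by omega) - z'.v (n + 1) n (by omega)) (fun j hj ↦ by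
    rw [Preadditive.comp_sub, sub_eq_zero]
    exact h _ j hj _ _)
  rw [Preadditive.comp_sub, sub_eq_zero, Category.assoc, Category.assoc] at key
  rw [δ_v (-1) 0 (by omega) z n n _ (n - 1) (n + 1) rfl rfl,
    δ_v (-1) 0 (by omega) z' n n _ (n - 1) (n + 1) rfl rfl]
  simp only [Preadditive.comp_add, Int.negOnePow_zero, one_smul, ← Category.assoc] at key ⊢
  rw [key, h n i hi (n - 1) (by omega)]

end Basis

section

variable {B : Type u} [Category.{v} B] [Preadditive B]

/-- A cochain complex is small free if its terms are coproducts of fewer than `κ` copies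
of the object `P`. -/
def IsSmallFree (P : B) (κ : Cardinal.{v}) (S : CochainComplex B ℤ) : Prop :=
  ∃ (ι : ℤ → Type v) (b : ∀ n, ι n → (P ⟶ S.X n)),
    (∀ n, Nonempty (IsColimit (Cofan.mk (S.X n) (b n)))) ∧ ∀ n, HasCardinalLT (ι n) κ

/-- A morphism of complexes is a coboundary if it is the differential of a cochain of
degree `-1`, i.e. if it is homotopic to zero. -/
def IsCoboundary {S Y : CochainComplex B ℤ} (f : S ⟶ Y) : Prop :=
  ∃ z : Cochain S Y (-1), δ (-1) 0 z = Cochain.ofHom f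

end

/-! ### Subquotients and null-homotopies -/

section Subquotient

variable {B : Type u} [Category.{v} B] [Preadditive B] [HasCoproducts.{v} B] {P : B}
  {T : CochainComplex B ℤ} {ι : ℤ → Type v} {b : ∀ n, ι n → (P ⟶ T.X n)}
  (hb : ∀ n, IsColimit (Cofan.mk (T.X n) (b n))) (J C : Set (Σ n, ι n))

variable (ι) in
/-- The indices in degree `n` of a basis of the subquotient attached to subsets `J` and `C`. -/
abbrev SubquotientIndex (n : ℤ) : Type v := { i : ι n // ⟨n, i⟩ ∈ C ∧ ⟨n, i⟩ ∉ J }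

variable (P) in
/-- The terms of the subquotient attached to subsets `J` and `C` of a basis. -/
noncomputable abbrev SubquotientX (n : ℤ) : B := ∐ fun _ : SubquotientIndex ι J C n ↦ P

variable (b) in
/-- The inclusion of the subquotient, on underlying graded objects. -/
noncomputable def subquotientι (n : ℤ) : SubquotientX P J C n ⟶ T.X n :=
  Sigma.desc fun i ↦ b n i.1

open scoped Classical in
/-- The projection to the subquotient, on underlying graded objects. -/
noncomputable def subquotientπ (n : ℤ) : T.X n ⟶ SubquotientX P J C n :=
  Cofan.IsColimit.desc (hb n) fun i ↦
    if hi : ⟨n, i⟩ ∈ C ∧ ⟨n, i⟩ ∉ J then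
      Sigma.ι (fun _ : SubquotientIndex ι J C n ↦ P) ⟨i, hi⟩ else 0

variable (b) in
lemma ι_subquotientι {n : ℤ} (i : SubquotientIndex ι J C n) :
    Sigma.ι (fun _ : SubquotientIndex ι J C n ↦ P) i ≫ subquotientι b J C n = b n i.1 := by
  simp [subquotientι]

lemma basis_subquotientπ {n : ℤ} (i : ι n) (hi : ⟨n, i⟩ ∈ C ∧ ⟨n, i⟩ ∉ J) :
    b n i ≫ subquotientπ hb J C n =
      Sigma.ι (fun _ : SubquotientIndex ι J C n ↦ P) ⟨i, hi⟩ :=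
  (Cofan.IsColimit.fac (hb n) _ i).trans (dif_pos hi)

lemma basis_subquotientπ_eq_zero {n : ℤ} (i : ι n) (hi : ¬ (⟨n, i⟩ ∈ C ∧ ⟨n, i⟩ ∉ J)) :
    b n i ≫ subquotientπ hb J C n = 0 :=
  (Cofan.IsColimit.fac (hb n) _ i).trans (dif_neg hi)

variable {J C}

lemma Supported.comp_subquotientπ_eq_zero {A : B} {n : ℤ} {x : A ⟶ T.X n}
    (hx : Supported (b n) (Sigma.mk n ⁻¹' J) x) :
    x ≫ subquotientπ hb J C n = 0 :=
  hx _ fun i hi ↦ basis_subquotientπ_eq_zero hb J C i fun h ↦ h.2 hi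

/-- Projecting to the span of `C \ J` only discards components in `J`, which `φ` kills. -/
lemma Supported.comp_subquotientπ_subquotientι {A : B} {n : ℤ} {x : A ⟶ T.X n}
    (hx : Supported (b n) (Sigma.mk n ⁻¹' C) x) {Z : B} (φ : T.X n ⟶ Z)
    (hφ : ∀ i : ι n, ⟨n, i⟩ ∈ J → b n i ≫ φ = 0) :
    x ≫ subquotientπ hb J C n ≫ subquotientι b J C n ≫ φ = x ≫ φ := by
  rw [← sub_eq_zero, ← Preadditive.comp_sub]
  refine hx _ fun i hi ↦ ?_
  rw [Preadditive.comp_sub, sub_eq_zero, ← Category.assoc]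
  by_cases hi' : ⟨n, i⟩ ∈ J
  · rw [basis_subquotientπ_eq_zero hb J C i fun h ↦ h.2 hi', zero_comp, hφ i hi']
  · rw [basis_subquotientπ hb J C i ⟨hi, hi'⟩, ← Category.assoc, ι_subquotientι]

lemma DifferentialClosed.ι_subquotientι_d (hC : DifferentialClosed b C) {n : ℤ}
    {Z : B} (φ : T.X (n + 1) ⟶ Z) (hφ : ∀ i : ι (n + 1), ⟨n + 1, i⟩ ∈ J → b _ i ≫ φ = 0) :
    subquotientι b J C n ≫ T.d n (n + 1) ≫ subquotientπ hb J C (n + 1) ≫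
      subquotientι b J C (n + 1) ≫ φ = subquotientι b J C n ≫ T.d n (n + 1) ≫ φ := by
  refine Sigma.hom_ext _ _ fun i ↦ ?_
  rw [reassoc_of% ι_subquotientι b J C i, reassoc_of% ι_subquotientι b J C i]
  simpa only [Category.assoc] using (hC i.1 i.2.1).comp_subquotientπ_subquotientι hb φ hφ

/-- The subquotient of a complex with a basis attached to subsets `J` and `C` of the
basis which are closed under the differential: its basis is `C \ J`. -/
noncomputable def subquotient (hJ : DifferentialClosed b J) (hC : DifferentialClosed b C) :
    CochainComplex B ℤ where
  X n := SubquotientX P J C n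
  d p q := subquotientι b J C p ≫ T.d p q ≫ subquotientπ hb J C q
  shape p q hpq := by rw [T.shape p q hpq, zero_comp, comp_zero]
  d_comp_d' := by
    rintro p _ _ rfl rfl
    have := hC.ι_subquotientι_d hb (T.d (p + 1) (p + 1 + 1) ≫ subquotientπ hb J C (p + 1 + 1))
      (fun i hi ↦ by
        rw [← Category.assoc]
        exact (hJ i hi).comp_subquotientπ_eq_zero hb)
    rw [Category.assoc, Category.assoc, this, T.d_comp_d_assoc, zero_comp, comp_zero]

lemma isSmallFree_subquotient (hJ : DifferentialClosed b J) (hC : DifferentialClosed b C)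
    {κ : Cardinal.{v}} (hκ : HasCardinalLT C κ) :
    IsSmallFree P κ (subquotient hb hJ hC) :=
  ⟨SubquotientIndex ι J C, fun n i ↦ Sigma.ι (fun _ : SubquotientIndex ι J C n ↦ P) i,
    fun n ↦ ⟨coproductIsCoproduct _⟩, fun n ↦ hκ.of_injective (fun i ↦ ⟨_, i.2.1⟩) (by
      rintro ⟨i, hi⟩ ⟨j, hj⟩ h
      simpa using h)⟩

/-- A morphism which vanishes on `J` induces a morphism from the subquotient. -/
noncomputable def subquotientDesc (hJ : DifferentialClosed b J) (hC : DifferentialClosed b C)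
    {Y : CochainComplex B ℤ} (f : T ⟶ Y)
    (hf : ∀ (n : ℤ) (i : ι n), ⟨n, i⟩ ∈ J → b n i ≫ f.f n = 0) :
    subquotient hb hJ hC ⟶ Y where
  f n := subquotientι b J C n ≫ f.f n
  comm' := by
    rintro n _ rfl
    change (subquotientι b J C n ≫ f.f n) ≫ Y.d n (n + 1) =
      (subquotientι b J C n ≫ T.d n (n + 1) ≫ subquotientπ hb J C (n + 1)) ≫
        subquotientι b J C (n + 1) ≫ f.f (n + 1)
    rw [Category.assoc, Category.assoc, Category.assoc,
      hC.ι_subquotientι_d hb _ (hf (n + 1)), f.comm]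

/-- A morphism which vanishes on a closed set `J` is a coboundary on the union with a closed
set `C` as soon as the induced morphism from the subquotient is a coboundary. -/
lemma exists_cochain_of_isCoboundary_subquotientDesc
    (hJ : DifferentialClosed b J) (hC : DifferentialClosed b C)
    {Y : CochainComplex B ℤ} (f : T ⟶ Y)
    (hf : ∀ (n : ℤ) (i : ι n), ⟨n, i⟩ ∈ J → b n i ≫ f.f n = 0)
    (h : IsCoboundary (subquotientDesc hb hJ hC f hf)) :
    ∃ z : Cochain T Y (-1),
      (∀ (n : ℤ) (i : ι n), ⟨n, i⟩ ∈ J → ∀ (m : ℤ) (hm : n + (-1) = m), b n i ≫ z.v n m hm = 0) ∧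
      ∀ (n : ℤ) (i : ι n), ⟨n, i⟩ ∈ J ∪ C →
        b n i ≫ (δ (-1) 0 z).v n n (add_zero n) = b n i ≫ f.f n := by
  obtain ⟨w, hw⟩ := h
  obtain ⟨w, hw⟩ : ∃ w : ∀ p q : ℤ, p + (-1) = q → (SubquotientX P J C p ⟶ Y.X q),
      ∀ n, w n (n - 1) (by omega) ≫ Y.d (n - 1) n +
        (subquotientι b J C n ≫ T.d n (n + 1) ≫ subquotientπ hb J C (n + 1)) ≫
          w (n + 1) n (by omega) = subquotientι b J C n ≫ f.f n := by
    refine ⟨fun p q hpq ↦ w.v p q hpq, fun n ↦ ?_⟩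
    have := Cochain.congr_v hw n n (add_zero n)
    rw [δ_v (-1) 0 (by omega) w n n _ (n - 1) (n + 1) rfl rfl, Cochain.ofHom_v,
      Int.negOnePow_zero, one_smul] at this
    exact this
  let z : Cochain T Y (-1) := Cochain.mk fun p q hpq ↦ subquotientπ hb J C p ≫ w p q hpq
  have hz (p q : ℤ) (hpq : p + (-1) = q) : z.v p q hpq = subquotientπ hb J C p ≫ w p q hpq := rfl
  have hδ (n : ℤ) : (δ (-1) 0 z).v n n (add_zero n) =
      subquotientπ hb J C n ≫ w n (n - 1) (by omega) ≫ Y.d (n - 1) n +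
        T.d n (n + 1) ≫ subquotientπ hb J C (n + 1) ≫ w (n + 1) n (by omega) := by
    rw [δ_v (-1) 0 (by omega) z n n _ (n - 1) (n + 1) rfl rfl]
    simp [hz]
  have hzJ (n : ℤ) (i : ι n) (hi : ⟨n, i⟩ ∈ J) : b n i ≫ subquotientπ hb J C n = 0 :=
    basis_subquotientπ_eq_zero hb J C i fun h ↦ h.2 hi
  refine ⟨z, fun n i hi m hm ↦ ?_, fun n i hi ↦ ?_⟩
  · rw [hz, ← Category.assoc, hzJ n i hi, zero_comp]
  -- On `J` both sides vanish, since the differential of `b n i` stays supported on `J`; on `C \ J`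
  -- the homotopy from the subquotient applies.
  · by_cases hi' : ⟨n, i⟩ ∈ J
    · have := (hJ i hi').comp_subquotientπ_eq_zero (C := C) hb
      rw [Category.assoc] at this
      rw [hδ, hf n i hi', Preadditive.comp_add, reassoc_of% (hzJ n i hi'), zero_comp, zero_add,
        reassoc_of% this, zero_comp]
    · have hiC : ⟨n, i⟩ ∈ C ∧ ⟨n, i⟩ ∉ J := ⟨hi.resolve_left hi', hi'⟩
      have := Sigma.ι (fun _ : SubquotientIndex ι J C n ↦ P) ⟨i, hiC⟩ ≫= hw n
      simp only [Category.assoc, Preadditive.comp_add, reassoc_of% ι_subquotientι b J C] at this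
      rw [hδ, Preadditive.comp_add, ← this, ← Category.assoc, basis_subquotientπ hb J C i hiC]

end Subquotient

/-! ### Extending null-homotopies by Zorn's lemma -/

section Zorn

variable {B : Type u} [Category.{v} B] [Preadditive B] {P : B}
  {T Y : CochainComplex B ℤ} {ι : ℤ → Type v} (b : ∀ n, ι n → (P ⟶ T.X n)) (f : T ⟶ Y)

/-- A partial cobounding cochain for a morphism `f : T ⟶ Y` consists of a set of basis elements of
`T` which is closed under the differential, and of a cochain whose differential agrees with `f`
on this set. -/
structure PartialCobounding where
  /-- the underlying set -/
  carrier : Set (Σ n, ι n)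
  /-- the underlying cochain -/
  cochain : Cochain T Y (-1)
  closed : DifferentialClosed b carrier
  comp_δ : ∀ (n : ℤ) (i : ι n), ⟨n, i⟩ ∈ carrier →
    b n i ≫ (δ (-1) 0 cochain).v n n (add_zero n) = b n i ≫ f.f n

namespace PartialCobounding

variable {b f}

/-- One partial cobounding cochain extends another one. -/
def Extends (p q : PartialCobounding b f) : Prop :=
  p.carrier ⊆ q.carrier ∧ ∀ (n : ℤ) (i : ι n), ⟨n, i⟩ ∈ p.carrier → ∀ (m : ℤ) (hm : n + (-1) = m),
    b n i ≫ p.cochain.v n m hm = b n i ≫ q.cochain.v n m hm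

lemma Extends.trans {p q r : PartialCobounding b f} (h : Extends p q) (h' : Extends q r) :
    Extends p r :=
  ⟨h.1.trans h'.1, fun n i hi m hm ↦ (h.2 n i hi m hm).trans (h'.2 n i (h.1 hi) m hm)⟩

open scoped Classical in
lemma exists_extends_of_isChain (hb : ∀ n, IsColimit (Cofan.mk (T.X n) (b n)))
    (c : Set (PartialCobounding b f)) (hc : IsChain Extends c) :
    ∃ q, ∀ p ∈ c, Extends p q := by
  -- Glue on the basis: any member of the chain containing `i` gives the same value, and `0` is a
  -- filler outside the union.
  let z : Cochain T Y (-1) := Cochain.mk fun n m hm ↦ Cofan.IsColimit.desc (hb n) fun i ↦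
    if h : ∃ p ∈ c, (⟨n, i⟩ : Σ n, ι n) ∈ p.carrier then b n i ≫ h.choose.cochain.v n m hm else 0
  have hz (p) (hp : p ∈ c) (n : ℤ) (i : ι n) (hi : ⟨n, i⟩ ∈ p.carrier) (m : ℤ)
      (hm : n + (-1) = m) : b n i ≫ p.cochain.v n m hm = b n i ≫ z.v n m hm := by
    have h : ∃ p ∈ c, (⟨n, i⟩ : Σ n, ι n) ∈ p.carrier := ⟨p, hp, hi⟩
    have h₁ : b n i ≫ z.v n m hm = b n i ≫ h.choose.cochain.v n m hm :=
      (Cofan.IsColimit.fac (hb n) _ i).trans (dif_pos h)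
    rw [h₁]
    by_cases heq : p = h.choose
    · rw [← heq]
    · obtain h₂ | h₂ := hc hp h.choose_spec.1 heq
      · exact h₂.2 n i hi m hm
      · exact (h₂.2 n i h.choose_spec.2 m hm).symm
  refine ⟨⟨⋃ p ∈ c, p.carrier, z, ?_, ?_⟩, fun p hp ↦
    ⟨Set.subset_biUnion_of_mem (u := fun p : PartialCobounding b f ↦ p.carrier) hp,
      fun n i hi m hm ↦ hz p hp n i hi m hm⟩⟩
  · intro n i hi
    obtain ⟨p, hp, hi⟩ := Set.mem_iUnion₂.1 hi
    exact (p.closed i hi).mono fun j hj ↦ Set.mem_iUnion₂.2 ⟨p, hp, hj⟩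
  · intro n i hi
    obtain ⟨p, hp, hi⟩ := Set.mem_iUnion₂.1 hi
    rw [← p.comp_δ n i hi]
    exact (p.closed.comp_δ_eq (hz p hp) i hi).symm

lemma exists_extends_union [HasCoproducts.{v} B] (hb : ∀ n, IsColimit (Cofan.mk (T.X n) (b n)))
    (p : PartialCobounding b f) {C : Set (Σ n, ι n)} (hC : DifferentialClosed b C)
    (h : ∀ g : subquotient hb p.closed hC ⟶ Y, IsCoboundary g) :
    ∃ q, Extends p q ∧ C ⊆ q.carrier := by
  -- Subtracting the coboundary already found leaves a morphism of complexes vanishing on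
  -- `p.carrier`, which descends to the subquotient.
  let w : Cocycle T Y 0 := Cocycle.mk (δ (-1) 0 p.cochain) 1 rfl (δ_δ _ _ _ _)
  let f' : T ⟶ Y := f - (Cocycle.equivHom T Y).symm w
  have hf' (n : ℤ) : f'.f n = f.f n - (δ (-1) 0 p.cochain).v n n (add_zero n) := rfl
  obtain ⟨z, hz₁, hz₂⟩ := exists_cochain_of_isCoboundary_subquotientDesc hb p.closed hC f'
    (fun n i hi ↦ by rw [hf', Preadditive.comp_sub, p.comp_δ n i hi, sub_self]) (h _)
  refine ⟨⟨p.carrier ∪ C, p.cochain + z, p.closed.union hC, fun n i hi ↦ ?_⟩,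
    ⟨Set.subset_union_left, fun n i hi m hm ↦ ?_⟩, Set.subset_union_right⟩
  · rw [δ_add, Cochain.add_v, Preadditive.comp_add, hz₂ n i hi, hf', Preadditive.comp_sub]
    abel
  · rw [Cochain.add_v, Preadditive.comp_add, hz₁ n i hi m hm, add_zero]

end PartialCobounding

/-- If all morphisms to `Y` from small free complexes are coboundaries, the same holds for
morphisms from any complex whose terms are coproducts of copies of `P`. -/
lemma isCoboundary_of_basis [HasCoproducts.{v} B] (κ : Cardinal.{v}) [Fact κ.IsRegular]
    (hκ : Cardinal.aleph0 < κ) [IsCardinalPresentable P κ]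
    (hb : ∀ n, IsColimit (Cofan.mk (T.X n) (b n)))
    (hY : ∀ (S : CochainComplex B ℤ), IsSmallFree P κ S → ∀ g : S ⟶ Y, IsCoboundary g) :
    IsCoboundary f := by
  obtain ⟨p, hp⟩ := exists_maximal_of_chains_bounded
    (PartialCobounding.exists_extends_of_isChain (f := f) hb)
    (fun {_ _ _} ↦ PartialCobounding.Extends.trans)
  have huniv (e : Σ n, ι n) : e ∈ p.carrier := by
    obtain ⟨C, he, hCκ, hC⟩ := exists_differentialClosed κ hκ hb e
    obtain ⟨q, hpq, hCq⟩ := p.exists_extends_union hb hC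
      (hY _ (isSmallFree_subquotient hb p.closed hC hCκ))
    -- `Extends` is only a preorder: maximality says that `p` extends `q` in turn, which suffices to
    -- compare carriers.
    exact (hp q hpq).1 (hCq he)
  refine ⟨p.cochain, ?_⟩
  ext n
  rw [Cochain.ofHom_v]
  exact Cofan.IsColimit.hom_ext (hb n) _ _ fun i ↦ p.comp_δ n i (huniv _)

end Zorn

/-! ### From free terms to projective terms -/

section

variable {B : Type u} [Category.{v} B] [Preadditive B]

lemma IsCoboundary.comp {S T Y : CochainComplex B ℤ} (g : S ⟶ T) {f : T ⟶ Y}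
    (hf : IsCoboundary f) : IsCoboundary (g ≫ f) := by
  obtain ⟨z, hz⟩ := hf
  refine ⟨(Cochain.ofHom g).comp z (zero_add _), ?_⟩
  rw [δ_ofHom_comp, hz, Cochain.ofHom_comp]

lemma isCoboundary_iff_quotient_map_eq_zero {S Y : CochainComplex B ℤ} (f : S ⟶ Y) :
    IsCoboundary f ↔ (HomotopyCategory.quotient B (.up ℤ)).map f = 0 := by
  constructor
  · rintro ⟨z, hz⟩
    rw [← (HomotopyCategory.quotient B (.up ℤ)).map_zero]
    exact HomotopyCategory.eq_of_homotopy _ _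
      ((Cochain.equivHomotopy f 0).symm ⟨z, by rw [hz, Cochain.ofHom_zero, add_zero]⟩)
  · intro h
    rw [← (HomotopyCategory.quotient B (.up ℤ)).map_zero] at h
    obtain ⟨z, hz⟩ := Cochain.equivHomotopy f 0 (HomotopyCategory.homotopyOfEq _ _ h)
    exact ⟨z, by rw [hz, Cochain.ofHom_zero, add_zero]⟩

/-- A complex whose terms are retracts of the objects `F n` is a retract of a complex with
terms `F n`. -/
lemma exists_retract_of_retract_X (T : CochainComplex B ℤ) (F : ℤ → B)
    (r : ∀ n, Retract (T.X n) (F n)) :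
    ∃ (T' : CochainComplex B ℤ), T'.X = F ∧ Nonempty (Retract T T') := by
  refine ⟨
    { X := F
      -- This squares to zero because the inner `i ≫ r` is the identity.
      d p q := (r p).r ≫ T.d p q ≫ (r q).i
      shape p q hpq := by rw [T.shape p q hpq, zero_comp, comp_zero]
      d_comp_d' := by simp }, rfl, ⟨
    { i := { f n := (r n).i }
      r := { f n := (r n).r } }⟩⟩

/-- If all morphisms to `Y` from small free complexes are coboundaries, the same holds for
morphisms from any complex of projective objects. -/
lemma isCoboundary_of_projective {B : Type u} [Category.{v} B] [Abelian B]
    [HasCoproducts.{v} B] {P : B} (hP : IsSeparator P) (κ : Cardinal.{v}) [Fact κ.IsRegular]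
    (hκ : Cardinal.aleph0 < κ) [IsCardinalPresentable P κ] {T Y : CochainComplex B ℤ}
    (hT : ∀ n, Projective (T.X n)) (f : T ⟶ Y)
    (hY : ∀ (S : CochainComplex B ℤ), IsSmallFree P κ S → ∀ g : S ⟶ Y, IsCoboundary g) :
    IsCoboundary f := by
  choose ι r using fun n ↦ exists_retract_sigma hP (T.X n)
  obtain ⟨⟨X, d, _, _⟩, rfl, ⟨ρ⟩⟩ := exists_retract_of_retract_X T _ fun n ↦ (r n).some
  have := (isCoboundary_of_basis (fun n (i : ι n) ↦ Sigma.ι (fun _ : ι n ↦ P) i) (ρ.r ≫ f) κ hκ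
    (fun n ↦ coproductIsCoproduct _) hY).comp ρ.i
  rwa [← Category.assoc, ρ.retract, Category.id_comp] at this

end

/-! ### Small free complexes and the small object argument -/

section SmallFreeData

variable {B : Type u} [Category.{v} B] [Preadditive B] [HasCoproducts.{v} B]
  (P : B) (κ : Cardinal.{v})

/-- The data of a small free complex whose bases are subsets of a fixed set. -/
structure SmallFreeData where
  /-- the bases -/
  J : ℤ → Set κ.ord.ToType
  hasCardinalLT : ∀ n, HasCardinalLT (J n) κ
  /-- the differential -/
  d : ∀ p q, (∐ fun _ : J p ↦ P) ⟶ ∐ fun _ : J q ↦ P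
  shape : ∀ p q, ¬ (ComplexShape.up ℤ).Rel p q → d p q = 0
  d_comp_d : ∀ p q r, (ComplexShape.up ℤ).Rel p q → (ComplexShape.up ℤ).Rel q r →
    d p q ≫ d q r = 0

variable {P κ}

/-- The small free complex attached to a datum `D : SmallFreeData P κ`. -/
noncomputable def SmallFreeData.toComplex (D : SmallFreeData P κ) : CochainComplex B ℤ where
  X n := ∐ fun _ : D.J n ↦ P
  d := D.d
  shape := D.shape
  d_comp_d' := D.d_comp_d

lemma SmallFreeData.isSmallFree (D : SmallFreeData P κ) : IsSmallFree P κ D.toComplex :=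
  ⟨fun n ↦ D.J n, fun n i ↦ Sigma.ι (fun _ : D.J n ↦ P) i, fun _ ↦ ⟨coproductIsCoproduct _⟩,
    D.hasCardinalLT⟩

lemma IsSmallFree.exists_iso {S : CochainComplex B ℤ} (hS : IsSmallFree P κ S) :
    ∃ D : SmallFreeData P κ, Nonempty (S ≅ D.toComplex) := by
  obtain ⟨ι, b, hb, hι⟩ := hS
  have hJ (n : ℤ) : ∃ J : Set κ.ord.ToType, Nonempty (ι n ≃ J) := by
    have : Cardinal.mk (ι n) ≤ Cardinal.mk κ.ord.ToType := by
      simpa using ((hasCardinalLT_iff_cardinal_mk_lt _ _).1 (hι n)).le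
    obtain ⟨f⟩ := this
    exact ⟨Set.range f, ⟨Equiv.ofInjective f f.injective⟩⟩
  choose J e using hJ
  let φ (n : ℤ) : S.X n ≅ ∐ fun _ : J n ↦ P :=
    (hb n).some.coconePointUniqueUpToIso (coproductIsCoproduct fun _ : ι n ↦ P) ≪≫
      Sigma.whiskerEquiv (e n).some (fun _ ↦ Iso.refl P)
  let D : SmallFreeData P κ :=
    { J := J
      hasCardinalLT _ := (hasCardinalLT_iff_of_equiv (e _).some κ).1 (hι _)
      d p q := (φ p).inv ≫ S.d p q ≫ (φ q).hom
      shape p q hpq := by rw [S.shape p q hpq, zero_comp, comp_zero]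
      d_comp_d p q r _ _ := by simp }
  exact ⟨D, ⟨HomologicalComplex.Hom.isoOfComponents φ
    (fun p q _ ↦ by simp [D, SmallFreeData.toComplex])⟩⟩

lemma IsSmallFree.projective_X {S : CochainComplex B ℤ} (hS : IsSmallFree P κ S) [Projective P]
    (n : ℤ) : Projective (S.X n) := by
  obtain ⟨ι, b, hb, hι⟩ := hS
  exact Projective.of_iso
    ((coproductIsCoproduct fun _ : ι n ↦ P).coconePointUniqueUpToIso (hb n).some)
    (inferInstanceAs (Projective (∐ fun _ : ι n ↦ P)))

variable [HasBinaryBiproducts B]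

variable (P κ) in
/-- The inclusions of small free complexes into their cones. -/
noncomputable def smallFreeCells : MorphismProperty (CochainComplex B ℤ) :=
  .ofHoms fun D : SmallFreeData P κ ↦ mappingCone.inr (𝟙 D.toComplex)

end SmallFreeData

section

variable {B : Type u} [Category.{v} B] [Abelian B] [HasColimitsOfSize.{v, v} B]
  {P : B} {κ : Cardinal.{v}}

lemma IsSmallFree.isCardinalPresentable [Fact κ.IsRegular]
    (hκ' : Cardinal.aleph0 < κ) [IsCardinalPresentable P κ]
    {S : CochainComplex B ℤ} (hS : IsSmallFree P κ S) : IsCardinalPresentable S κ := by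
  obtain ⟨ι, b, hb, hι⟩ := hS
  have (n : ℤ) : IsCardinalPresentable (S.X n) κ := by
    have (i : Discrete (ι n)) :
        IsCardinalPresentable ((Discrete.functor fun _ : ι n ↦ P).obj i) κ :=
      inferInstanceAs (IsCardinalPresentable P κ)
    exact isCardinalPresentable_of_isColimit (Cofan.mk (S.X n) (b n)) (hb n).some κ
      ((hasCardinalLT_arrow_discrete_iff _).2 (hι n))
  exact isCardinalPresentable_cochainComplex S κ hκ'

-- The cells are indexed by a `v`-small type, and their sources are `κ`-presentable because `κ` is
-- uncountable.
variable (P κ) in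
lemma hasSmallObjectArgument_smallFreeCells [Fact κ.IsRegular] (hκ : Cardinal.aleph0 < κ)
    [IsCardinalPresentable P κ] :
    MorphismProperty.HasSmallObjectArgument.{v} (smallFreeCells P κ) := by
  have : Nonempty κ.ord.ToType := by
    simpa using (Fact.out : κ.IsRegular).ne_zero
  have := WellFoundedLT.toOrderBot κ.ord.ToType
  have : HasColimitsOfSize.{v, v} (CochainComplex B ℤ) := ⟨fun _ _ ↦ inferInstance⟩
  exact ⟨κ, inferInstance, inferInstance,
    { isSmall := MorphismProperty.isSmall_ofHoms _
      preservesColimit := by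
        rintro _ _ X Y _ ⟨D⟩ f hf
        have := D.isSmallFree.isCardinalPresentable hκ
        have := preservesColimitsOfShape_of_isCardinalPresentable D.toComplex κ κ.ord.ToType
        infer_instance }⟩

end

section

variable {B : Type u} [Category.{v} B] [Preadditive B] [HasBinaryBiproducts B]

/-- An extension over the cone of `𝟙 S` is a null-homotopy, read off on the shifted summand. -/
lemma isCoboundary_of_extension {S Y : CochainComplex B ℤ} (f : S ⟶ Y)
    (φ : mappingCone (𝟙 S) ⟶ Y) (h : mappingCone.inr (𝟙 S) ≫ φ = f) : IsCoboundary f := by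
  refine ⟨(mappingCone.inl (𝟙 S)).comp (Cochain.ofHom φ) (add_zero _), ?_⟩
  rw [δ_comp_ofHom, mappingCone.δ_inl, ← Cochain.ofHom_comp, Category.id_comp, h]

lemma isCoboundary_of_rlp_smallFreeCells [HasCoproducts.{v} B] [HasZeroObject B] {P : B}
    {κ : Cardinal.{v}} {Y Z : CochainComplex B ℤ} (p : Y ⟶ Z) (hZ : IsZero Z)
    (hp : (smallFreeCells P κ).rlp p) {S : CochainComplex B ℤ} (hS : IsSmallFree P κ S)
    (f : S ⟶ Y) : IsCoboundary f := by
  obtain ⟨D, ⟨e⟩⟩ := hS.exists_iso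
  have := hp _ ⟨D⟩
  have sq : CommSq (e.inv ≫ f) (mappingCone.inr (𝟙 D.toComplex)) p 0 := ⟨hZ.eq_of_tgt _ _⟩
  have := (isCoboundary_of_extension _ sq.lift sq.fac_left).comp e.hom
  rwa [e.hom_inv_id_assoc] at this

/-- The inclusion of a complex of projective objects in its cone has the left lifting property with
respect to epimorphisms in each degree. -/
lemma hasLiftingProperty_inr_f (S : CochainComplex B ℤ) [∀ n, Projective (S.X n)] (n : ℤ)
    {A A' : B} (p : A ⟶ A') [Epi p] : HasLiftingProperty ((mappingCone.inr (𝟙 S)).f n) p where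
  sq_hasLift {f g} sq := ⟨⟨
    -- In degree `n` the cone is `S.X (n + 1) ⊞ S.X n`: projectivity lifts the first summand, and
    -- `f` is used on the second.
    { l := (mappingCone.fst (𝟙 S)).1.v n (n + 1) rfl ≫
          Projective.factorThru ((mappingCone.inl (𝟙 S)).v (n + 1) n (by omega) ≫ g) p +
        (mappingCone.snd (𝟙 S)).v n n (add_zero n) ≫ f
      fac_left := by simp
      fac_right := by
        rw [mappingCone.ext_from_iff _ (n + 1) n rfl]
        simp [sq.w] }⟩⟩

end

/-! ### Disks as right adjoints to evaluation -/

section Disk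

variable {B : Type u} [Category.{v} B] [HasZeroMorphisms B] [HasZeroObject B]
  {ι : Type*} {c : ComplexShape ι} {i₀ i₁ : ι} (hi₀₁ : c.Rel i₀ i₁)

open HomologicalComplex

open scoped Classical in
/-- Constructor for morphisms to the complex `double (𝟙 A)`. -/
noncomputable def homToDoubleId (h : i₀ ≠ i₁) {K : HomologicalComplex B c} {A : B}
    (φ : K.X i₁ ⟶ A) : K ⟶ double (𝟙 A) hi₀₁ where
  f k :=
    if hk₀ : k = i₀ then
      K.d k i₁ ≫ φ ≫ (doubleXIso₀ (𝟙 A) hi₀₁).inv ≫ eqToHom (by rw [hk₀])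
    else if hk₁ : k = i₁ then
      eqToHom (by rw [hk₁]) ≫ φ ≫ (doubleXIso₁ (𝟙 A) hi₀₁ h).inv ≫ eqToHom (by rw [hk₁])
    else 0
  comm' k₀ k₁ hk := by
    by_cases h₁ : k₁ = i₁
    · subst h₁
      obtain rfl := c.prev_eq hk hi₀₁
      simp [h.symm, double_d _ _ h]
    · rw [double_d_eq_zero₁ _ _ _ _ h₁, comp_zero]
      by_cases h₀ : k₁ = i₀
      · subst h₀
        simp
      · exact (isZero_double_X (𝟙 A) hi₀₁ k₁ h₀ h₁).eq_of_tgt _ _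

lemma homToDoubleId_f₀ (h : i₀ ≠ i₁) {K : HomologicalComplex B c} {A : B} (φ : K.X i₁ ⟶ A) :
    (homToDoubleId hi₀₁ h φ).f i₀ = K.d i₀ i₁ ≫ φ ≫ (doubleXIso₀ (𝟙 A) hi₀₁).inv := by
  simp [homToDoubleId]

lemma homToDoubleId_f₁ (h : i₀ ≠ i₁) {K : HomologicalComplex B c} {A : B} (φ : K.X i₁ ⟶ A) :
    (homToDoubleId hi₀₁ h φ).f i₁ = φ ≫ (doubleXIso₁ (𝟙 A) hi₀₁ h).inv := by
  simp [homToDoubleId, h.symm]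

/-- Morphisms to `double (𝟙 A)` identify with morphisms to `A` in the second degree. -/
noncomputable def homDoubleIdEquiv (h : i₀ ≠ i₁) (K : HomologicalComplex B c) (A : B) :
    (K.X i₁ ⟶ A) ≃ (K ⟶ double (𝟙 A) hi₀₁) where
  toFun φ := homToDoubleId hi₀₁ h φ
  invFun g := g.f i₁ ≫ (doubleXIso₁ (𝟙 A) hi₀₁ h).hom
  left_inv φ := by simp [homToDoubleId_f₁]
  right_inv g := by
    ext
    · have := g.comm i₀ i₁
      rw [double_d _ _ h] at this
      rw [homToDoubleId_f₀, Category.assoc, ← reassoc_of% this]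
      simp
    · simp [homToDoubleId_f₁]

lemma homDoubleIdEquiv_comp (h : i₀ ≠ i₁) {K' K : HomologicalComplex B c} {A : B} (f : K' ⟶ K)
    (g : K.X i₁ ⟶ A) :
    homDoubleIdEquiv hi₀₁ h K' A (f.f i₁ ≫ g) = f ≫ homDoubleIdEquiv hi₀₁ h K A g := by
  change homToDoubleId hi₀₁ h _ = f ≫ homToDoubleId hi₀₁ h _
  ext
  · simp [homToDoubleId_f₀]
  · simp [homToDoubleId_f₁]

/-- Evaluation at a degree which is the target of a differential has a right adjoint. -/
lemma isLeftAdjoint_eval (h : i₀ ≠ i₁) (hi₀₁ : c.Rel i₀ i₁) :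
    (HomologicalComplex.eval B c i₁).IsLeftAdjoint :=
  (Adjunction.adjunctionOfEquivRight (F := HomologicalComplex.eval B c i₁)
    (homDoubleIdEquiv hi₀₁ h) (fun _ _ _ f g ↦ homDoubleIdEquiv_comp hi₀₁ h f g)).isLeftAdjoint

end Disk

/-- Evaluation in degree `n` has a right adjoint, so lifting `l.f n` against `p` means lifting `l`
against the image of `p`, which lies in `I.rlp`. -/
lemma hasLiftingProperty_f_of_llp_rlp {B : Type u} [Category.{v} B] [HasZeroMorphisms B]
    [HasZeroObject B] {I : MorphismProperty (CochainComplex B ℤ)} {n : ℤ} {A A' : B} (p : A ⟶ A')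
    (hI : ∀ ⦃K L : CochainComplex B ℤ⦄ (i : K ⟶ L), I i → HasLiftingProperty (i.f n) p)
    {X Y : CochainComplex B ℤ} (l : X ⟶ Y) (hl : I.rlp.llp l) : HasLiftingProperty (l.f n) p := by
  have := isLeftAdjoint_eval (B := B) (c := ComplexShape.up ℤ) (i₀ := n - 1) (i₁ := n)
    (by omega) (by simp)
  let adj := Adjunction.ofIsLeftAdjoint (HomologicalComplex.eval B (.up ℤ) n)
  refine (adj.hasLiftingProperty_iff l p).2 ?_
  exact hl _ fun _ _ i hi ↦ (adj.hasLiftingProperty_iff i p).1 (hI i hi)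

/-! ### Embedding into a contraacyclic complex -/

section

variable {B : Type u} [Category.{v} B] [Abelian B]

lemma exists_retraction_of_llp_epi {X Y : B} (l : X ⟶ Y)
    (hl : ∀ ⦃A A' : B⦄ (p : A ⟶ A') [Epi p], HasLiftingProperty l p) :
    ∃ r : Y ⟶ X, l ≫ r = 𝟙 X := by
  have : Epi (0 : X ⟶ 0) := ⟨fun _ _ _ ↦ (isZero_zero B).eq_of_src _ _⟩
  have := hl (0 : X ⟶ 0)
  have sq : CommSq (𝟙 X) l (0 : X ⟶ 0) 0 := ⟨by simp⟩
  exact ⟨sq.lift, sq.fac_left⟩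

/-- A lift that is zero on `S.X₁` descends to the cokernel `S.X₃`. -/
lemma projective_of_llp_epi {S : ShortComplex B} (hS : S.Exact) [Epi S.g]
    (hl : ∀ ⦃A A' : B⦄ (p : A ⟶ A') [Epi p], HasLiftingProperty S.f p) :
    Projective S.X₃ where
  factors {E E'} f p _ := by
    have := hl p
    have sq : CommSq 0 S.f p (S.g ≫ f) := ⟨by simp⟩
    refine ⟨hS.desc sq.lift sq.fac_left, ?_⟩
    rw [← cancel_epi S.g, hS.g_desc_assoc, sq.fac_right]

/-- Any complex admits a degreewise split monomorphism with degreewise projective cokernel to a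
complex to which all morphisms from complexes of projective objects are homotopic to zero. -/
lemma exists_degreewiseSplit [IsLocallyPresentable.{v} B] [EnoughProjectives B]
    (X : CochainComplex B ℤ) :
    ∃ (S : ShortComplex (CochainComplex B ℤ)), S.X₁ = X ∧
      (∀ n, Nonempty ((S.map (HomologicalComplex.eval B _ n)).Splitting)) ∧
      (∀ n, Projective (S.X₃.X n)) ∧
      ∀ (T : CochainComplex B ℤ), (∀ n, Projective (T.X n)) → ∀ f : T ⟶ S.X₂, IsCoboundary f := by
  have := hasColimits_of_isLocallyPresentable B
  obtain ⟨P, _, hP⟩ := exists_projective_isSeparator B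
  obtain ⟨κ, _, hκ, _⟩ := exists_isCardinalPresentable_of_aleph0_lt P
  have := hasSmallObjectArgument_smallFreeCells P κ hκ
  let I := smallFreeCells P κ
  let φ := MorphismProperty.factorizationData I.rlp.llp I.rlp (0 : X ⟶ 0)
  have hφ (n : ℤ) ⦃A A' : B⦄ (p : A ⟶ A') [Epi p] : HasLiftingProperty (φ.i.f n) p := by
    refine hasLiftingProperty_f_of_llp_rlp p ?_ φ.i φ.hi
    rintro _ _ _ ⟨D⟩
    have := D.isSmallFree.projective_X
    exact hasLiftingProperty_inr_f D.toComplex n p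
  let S := ShortComplex.mk φ.i (cokernel.π φ.i) (cokernel.condition _)
  have hS : S.Exact := ShortComplex.exact_cokernel φ.i
  have hSn (n : ℤ) : (S.map (HomologicalComplex.eval B _ n)).Exact := hS.map _
  have (n : ℤ) : Epi (S.map (HomologicalComplex.eval B (ComplexShape.up ℤ) n)).g :=
    inferInstanceAs (Epi ((cokernel.π φ.i).f n))
  refine ⟨S, rfl, fun n ↦ ?_, fun n ↦ projective_of_llp_epi (hSn n) (hφ n), fun T hT f ↦ ?_⟩
  · obtain ⟨r, hr⟩ := exists_retraction_of_llp_epi (φ.i.f n) (hφ n)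
    exact ⟨ShortComplex.Splitting.ofExactOfRetraction _ (hSn n) r hr inferInstance⟩
  · exact isCoboundary_of_projective hP κ hκ hT f fun S hS g ↦
      isCoboundary_of_rlp_smallFreeCells φ.p (isZero_zero _) φ.hp hS g

end

/-! ### The adjunction and the equivalence -/

section

variable {B : Type u} [Category.{v} B] [Abelian B]

lemma mem_essImage_inclusion_of_projective (T : CochainComplex B ℤ)
    (hT : ∀ n, Projective (T.X n)) :
    (inclusion B).essImage ((HomotopyCategory.quotient B (.up ℤ)).obj T) := by
  let T' : CochainComplex (ProjObj B) ℤ :=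
    { X n := ⟨T.X n, hT n⟩
      d p q := ObjectProperty.homMk (T.d p q)
      shape p q hpq := by ext; exact T.shape p q hpq
      d_comp_d' p q r _ _ := by ext; exact T.d_comp_d p q r }
  exact (inclusion B).obj_mem_essImage ((HomotopyCategory.quotient _ (.up ℤ)).obj T')

lemma contraacyclic_quotient_obj (Y : CochainComplex B ℤ)
    (hY : ∀ (T : CochainComplex B ℤ), (∀ n, Projective (T.X n)) → ∀ f : T ⟶ Y, IsCoboundary f) :
    contraacyclic B ((HomotopyCategory.quotient B (.up ℤ)).obj Y) := by
  intro T f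
  obtain ⟨T, rfl⟩ := HomotopyCategory.quotient_obj_surjective T
  let T' := ((isProjective B).ι.mapHomologicalComplex (.up ℤ)).obj T
  obtain ⟨f, rfl⟩ := (HomotopyCategory.quotient B (.up ℤ)).map_surjective (X := T') f
  exact (isCoboundary_iff_quotient_map_eq_zero f).1 (hY T' (fun n ↦ (T.X n).property) f)

/-- Every complex receives a morphism from a complex of projective objects with a
contraacyclic cone. -/
lemma exists_trW_contraacyclic [IsLocallyPresentable.{v} B] [EnoughProjectives B] (X : K B) :
    ∃ (P : KProj B) (p : (inclusion B).obj P ⟶ X), (contraacyclic B).trW p := by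
  obtain ⟨X, rfl⟩ := HomotopyCategory.quotient_obj_surjective X
  obtain ⟨S, rfl, hS, hS₃, hS₂⟩ := exists_degreewiseSplit X
  let T := CochainComplex.trianglehOfDegreewiseSplit S fun n ↦ (hS n).some
  have hT : T ∈ distTriang _ :=
    (HomotopyCategory.distinguished_iff_iso_trianglehOfDegreewiseSplit T).2
      ⟨S, fun n ↦ (hS n).some, ⟨Iso.refl _⟩⟩
  obtain ⟨P, ⟨e⟩⟩ := mem_essImage_inclusion_of_projective S.X₃ hS₃
  have hY := contraacyclic_quotient_obj S.X₂ hS₂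
  -- The inverse rotation is `S.X₃⟦-1⟧ ⟶ S.X₁ ⟶ S.X₂`, so the cone of its first morphism is the
  -- contraacyclic `S.X₂`.
  have h : (contraacyclic B).trW T.invRotate.mor₁ := .mk _ (inv_rot_of_distTriang _ hT) hY
  let e' : (inclusion B).obj (P⟦(-1 : ℤ)⟧) ≅ T.invRotate.obj₁ :=
    ((inclusion B).commShiftIso (-1 : ℤ)).app P ≪≫ (CategoryTheory.shiftFunctor (K B) (-1 : ℤ)).mapIso e
  exact ⟨_, e'.hom ≫ T.invRotate.mor₁, MorphismProperty.RespectsIso.precomp _ e'.hom _ h⟩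

variable (B) in
lemma leftOrthogonal_contraacyclic_inclusion_obj (P : KProj B) :
    (contraacyclic B).leftOrthogonal ((inclusion B).obj P) :=
  fun _ f hY ↦ hY P f

/-- Composition with `p : P ⟶ X` is bijective on morphisms from complexes of projectives, so `p` is
terminal among such complexes over `X`. -/
lemma isLeftAdjoint_inclusion [IsLocallyPresentable.{v} B] [EnoughProjectives B] :
    (inclusion B).IsLeftAdjoint := by
  rw [isLeftAdjoint_iff_hasTerminal_costructuredArrow]
  intro X
  obtain ⟨P, p, hp⟩ := exists_trW_contraacyclic X
  have hbij (Q : KProj B) := by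
    have := leftOrthogonal_contraacyclic_inclusion_obj B Q
    rw [← ObjectProperty.isColocal_trW] at this
    exact this p hp
  have hex (Z : CostructuredArrow (inclusion B) X) :
      ∃ g : Z.left ⟶ P, (inclusion B).map g ≫ p = Z.hom := by
    obtain ⟨g, hg⟩ := (hbij Z.left).2 Z.hom
    exact ⟨(inclusion B).preimage g, by simpa using hg⟩
  choose g hg using hex
  refine IsTerminal.hasTerminal (X := CostructuredArrow.mk p)
    (IsTerminal.ofUniqueHom (fun Z ↦ CostructuredArrow.homMk (g Z) (hg Z)) (fun Z m ↦ ?_))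
  ext
  exact (inclusion B).map_injective ((hbij Z.left).1 ((CostructuredArrow.w m).trans (hg Z).symm))

lemma isEquivalence_comparison [IsLocallyPresentable.{v} B] [EnoughProjectives B] :
    (comparison B).IsEquivalence := by
  have hbij (P : KProj B) (X : K B) :
      Function.Bijective ((quotientFunctor B).map : ((inclusion B).obj P ⟶ X) → _) :=
    (leftOrthogonal_contraacyclic_inclusion_obj B P).map_bijective_of_isTriangulated _ X
  have : (comparison B).Faithful :=
    ⟨fun {_ _} _ _ h ↦ (inclusion B).map_injective ((hbij _ _).1 h)⟩
  have : (comparison B).Full :=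
    ⟨fun g ↦ by
      obtain ⟨f, rfl⟩ := (hbij _ _).2 g
      obtain ⟨f, rfl⟩ := (inclusion B).map_surjective f
      exact ⟨f, rfl⟩⟩
  have : (comparison B).EssSurj :=
    ⟨fun Y ↦ by
      have := Localization.essSurj (quotientFunctor B) (contraacyclic B).trW
      obtain ⟨P, p, hp⟩ := exists_trW_contraacyclic ((quotientFunctor B).objPreimage Y)
      have := Localization.inverts (quotientFunctor B) (contraacyclic B).trW p hp
      exact ⟨P, ⟨asIso ((quotientFunctor B).map p) ≪≫ (quotientFunctor B).objObjPreimageIso Y⟩⟩⟩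
  exact { }

end

end Contraderived

theorem mainTheorem6 (B : Type u) [Category.{v} B] [Abelian B]
    [IsLocallyPresentable.{v} B] [EnoughProjectives B] :
    (Contraderived.comparison B).IsTriangulated ∧
      (Contraderived.comparison B).IsEquivalence ∧
      (Contraderived.inclusion B).IsLeftAdjoint :=
  ⟨inferInstance, Contraderived.isEquivalence_comparison, Contraderived.isLeftAdjoint_inclusion⟩
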